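/- Let $h_0(t)=2^{1/4}e^{-\pi t^2}$, $t\in\mathbb R$, be the normalized Gaussian, let $p$ be a polynomial with complex coefficients, and let $g=p\,h_0$. For $f\in L^2(\mathbb R)$ (complex-valued) let $$V_gf(x,\xi)=\int_{\mathbb R} f(t)\,\overline{g(t-x)}\,e^{-2\pi i \xi t}\,dt,\qquad (x,\xi)\in\mathbb R^2,$$ be the short-time Fourier transform of $f$ with window $g$. If $V_gf(x,\xi)\neq 0$ for all $(x,\xi)\in\mathbb R^2$, then there exist a polynomial $q$ with complex coefficients and constants $a',b',c'\in\mathbb C$ with $\operatorname{Re} a'>0$ such that $f(x)=q(x)\,e^{-(a'x^2+b'x+c')}$ for almost every $x\in\mathbb R$. -/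

import Mathlib

open MeasureTheory

/-- The short-time Fourier transform on the real line,
`V_g f (x, ξ) = ∫ f(t) * conj (g(t - x)) * exp(-2πiξt) dt`. -/
noncomputable def stft (g f : ℝ → ℂ) (x ξ : ℝ) : ℂ :=
  ∫ t : ℝ, f t * (starRingEnd ℂ) (g (t - x)) *
    Complex.exp (-2 * (Real.pi : ℂ) * Complex.I * (ξ : ℂ) * (t : ℂ))

/-- The normalized Gaussian `h₀(t) = 2^(1/4) * exp(-πt²)`. -/
noncomputable def normalizedGaussian (t : ℝ) : ℂ :=
  (((2 : ℝ) ^ (1 / 4 : ℝ) * Real.exp (-Real.pi * t ^ 2) : ℝ) : ℂ)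

/-! Put `w = 2πx - 2πiξ` and `u(t) = f(t) exp(-πt²)`. Taylor expansion of the conjugate polynomial
`P` writes `V_g f`, up to a zero-free factor, as `F(w) = ∑ (-Re w / 2π)^k G_k(w)`, with each `G_k`
entire (`stft_eq_polyanalyticLaplace`). `F` is continuous and zero-free on the plane, so its winding
along every circle is `0`. On `‖w‖ = r` one has `Re w = (r² + w²) / (2w)`, so there a multiple of
`w^n F`, `n = deg P`, agrees with an entire function `A_r` (`circleLaplace_eq`). Hence `A_r` has
exactly `n` zeros in the disc. As `r → ∞`, `A_r` tends locally uniformly to the Laplace transform of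
`u`, which by Rouché has at most `n` zeros (`exists_factorization_of_hasWinding`). That transform is
`O(exp(‖w‖²))`, so by a Hadamard argument it is a polynomial times the exponential of a quadratic
(`Differentiable.exists_eq_exp_quadratic`). Fourier inversion gives `u`, hence `f`, the same form
(`ExpIntegrable.ae_eq_of_laplace_eq`), and `f ∈ L²` forces decay. -/

/-! ### Winding numbers through continuous logarithms. -/

/-- `HasWinding r G m`: along the circle of radius `r` about the origin, `G` has a continuous
logarithm whose total increment is `2πim`. -/
def HasWinding (r : ℝ) (G : ℂ → ℂ) (m : ℤ) : Prop :=
  ∃ c : ℝ → ℂ, Continuous c ∧ (∀ θ, Complex.exp (c θ) = G (circleMap 0 r θ)) ∧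
    c (2 * Real.pi) = c 0 + m * (2 * Real.pi * Complex.I)

namespace HasWinding

variable {r : ℝ} {G H : ℂ → ℂ} {m k : ℤ}

theorem unique (h : HasWinding r G m) (h' : HasWinding r G k) : m = k := by
  obtain ⟨c, hc, hce, hcw⟩ := h
  obtain ⟨d, hd, hde, hdw⟩ := h'
  have key : c = fun θ => d θ + (c 0 - d 0) := by
    refine Complex.isCoveringMap_exp.eq_of_comp_eq hc (by fun_prop) ?_ 0 (by simp)
    funext θ
    have h0 : Complex.exp (c 0 - d 0) = 1 := by
      rw [Complex.exp_sub, hce, ← hde, div_self (Complex.exp_ne_zero _)]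
    simp [Complex.exp_add, h0, hce, hde]
  have h1 := congrFun key (2 * Real.pi)
  simp only [hcw, hdw] at h1
  have h2 : ((m : ℂ) - k) * (2 * Real.pi * Complex.I) = 0 := by linear_combination h1
  have h3 : (m : ℂ) - k = 0 := (mul_eq_zero.mp h2).resolve_right Complex.two_pi_I_ne_zero
  exact_mod_cast sub_eq_zero.mp h3

theorem mul (h : HasWinding r G m) (h' : HasWinding r H k) :
    HasWinding r (fun z => G z * H z) (m + k) := by
  obtain ⟨c, hc, hce, hcw⟩ := h
  obtain ⟨d, hd, hde, hdw⟩ := h'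
  refine ⟨fun θ => c θ + d θ, by fun_prop, fun θ => by simp [Complex.exp_add, hce, hde], ?_⟩
  simp only [hcw, hdw]; push_cast; ring

theorem congr (hr : 0 ≤ r) (h : HasWinding r G m) (hGH : ∀ z, ‖z‖ = r → G z = H z) :
    HasWinding r H m := by
  obtain ⟨c, hc, hce, hcw⟩ := h
  refine ⟨c, hc, fun θ => ?_, hcw⟩
  rw [hce, hGH _ (by simp [abs_of_nonneg hr])]

/-- Rouché: `H / G` stays in the unit disc about `1`, so its principal logarithm is a continuous
periodic correction to the logarithm of `G`. -/
theorem of_norm_sub_lt (hr : 0 ≤ r) (h : HasWinding r G m)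
    (hH : ContinuousOn H (Metric.sphere 0 r)) (hlt : ∀ z, ‖z‖ = r → ‖H z - G z‖ < ‖G z‖) :
    HasWinding r H m := by
  obtain ⟨c, hc, hce, hcw⟩ := h
  have hs : ∀ θ, ‖circleMap 0 r θ‖ = r := fun θ => by simp [abs_of_nonneg hr]
  have hHc : Continuous fun θ => H (circleMap 0 r θ) :=
    hH.comp_continuous (continuous_circleMap 0 r) fun θ => by simp [hs]
  have hslit : ∀ θ, H (circleMap 0 r θ) / Complex.exp (c θ) ∈ Complex.slitPlane := by
    intro θ
    have h1 := hlt _ (hs θ)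
    rw [← hce] at h1
    have h2 : ‖H (circleMap 0 r θ) / Complex.exp (c θ) - 1‖ < 1 := by
      rw [div_sub_one (Complex.exp_ne_zero _), norm_div, div_lt_one (by simp [Complex.exp_ne_zero])]
      exact h1
    have := Complex.mem_slitPlane_of_norm_lt_one h2
    simpa using this
  refine ⟨fun θ => c θ + Complex.log (H (circleMap 0 r θ) / Complex.exp (c θ)), ?_, ?_, ?_⟩
  · refine hc.add (Continuous.clog ?_ hslit)
    exact hHc.div (by fun_prop) fun θ => Complex.exp_ne_zero _
  · intro θ
    rw [Complex.exp_add, Complex.exp_log (Complex.slitPlane_ne_zero (hslit θ))]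
    field_simp [Complex.exp_ne_zero]
  · have h1 : circleMap 0 r (2 * Real.pi) = circleMap 0 r 0 := by simp [circleMap]
    have h2 : Complex.exp (c (2 * Real.pi)) = Complex.exp (c 0) := by rw [hce, hce, h1]
    simp only [h1, h2]
    rw [hcw]; ring

/-- Continuity suffices, which matters because the polyanalytic function is not holomorphic.
Composing with a retraction onto the disc gives a zero-free function on the simply connected plane,
which has a global logarithm. -/
theorem of_continuousOn (hr : 0 ≤ r) (hG : ContinuousOn G (Metric.closedBall 0 r))
    (h0 : ∀ z ∈ Metric.closedBall (0 : ℂ) r, G z ≠ 0) : HasWinding r G 0 := by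
  -- The radial retraction onto the closed disc; for `r = 0` division by zero makes it the identity,
  -- hence the separate case below.
  let ρ : ℂ → ℂ := fun z => ((max 1 (‖z‖ / r) : ℝ) : ℂ)⁻¹ * z
  have hpos : ∀ z : ℂ, (0 : ℝ) < max 1 (‖z‖ / r) := fun z => by positivity
  have hρc : Continuous ρ := by
    refine Continuous.mul (Continuous.inv₀ (by fun_prop) fun z => ?_) continuous_id
    exact_mod_cast (hpos z).ne'
  have hρ : ∀ z, 0 < r → ρ z ∈ Metric.closedBall (0 : ℂ) r := by
    intro z hr
    have h1 : ‖ρ z‖ = ‖z‖ / max 1 (‖z‖ / r) := by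
      simp only [ρ, norm_mul, norm_inv, Complex.norm_real, Real.norm_of_nonneg (hpos z).le]
      ring
    rw [mem_closedBall_zero_iff, h1, div_le_iff₀ (hpos z)]
    calc ‖z‖ = r * (‖z‖ / r) := by field_simp
      _ ≤ _ := by gcongr; exact le_max_right _ _
  rcases hr.eq_or_lt with rfl | hr
  · have h := h0 0 (by simp)
    exact ⟨fun _ => Complex.log (G 0), continuous_const, fun θ => by simp [Complex.exp_log h],
      by simp⟩
  obtain ⟨u, hu, hue⟩ := Complex.exists_continuousOn_eqOn_exp_comp (U := (Set.univ : Set ℂ))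
    (g := G ∘ ρ) (by
      have : ContractibleSpace (Set.univ : Set ℂ) :=
        (convex_univ (𝕜 := ℝ)).contractibleSpace Set.univ_nonempty
      exact inferInstanceAs (SimplyConnectedSpace (Set.univ : Set ℂ))) isOpen_univ
    (hG.comp_continuous hρc fun z => hρ z hr).continuousOn
    (by rintro ⟨z, -, hz⟩; exact h0 _ (hρ z hr) hz)
  refine ⟨fun θ => u (circleMap 0 r θ),
    (continuousOn_univ.mp hu).comp (continuous_circleMap 0 r), fun θ => ?_, ?_⟩
  · have := hue (Set.mem_univ (circleMap 0 r θ))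
    simp only [Function.comp_apply] at this
    rw [this]
    congr 1
    simp [ρ, abs_of_pos hr, hr.ne']
  · simp [circleMap]

theorem id (hr : 0 < r) : HasWinding r (fun z => z) 1 := by
  refine ⟨fun θ => Real.log r + θ * Complex.I, by fun_prop, fun θ => ?_, ?_⟩
  · rw [Complex.exp_add, ← Complex.ofReal_exp, Real.exp_log hr, circleMap]; simp
  · push_cast; simp

theorem sub_const (a : ℂ) (ha : ‖a‖ < r) : HasWinding r (fun z => z - a) 1 := by
  have hr : 0 < r := (norm_nonneg a).trans_lt ha
  refine (HasWinding.id hr).of_norm_sub_lt hr.le (by fun_prop) fun z hz => ?_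
  simpa [hz] using ha

theorem one (hr : 0 ≤ r) : HasWinding r (fun _ => 1) 0 :=
  of_continuousOn hr continuousOn_const fun _ _ => one_ne_zero

theorem pow (hr : 0 ≤ r) (h : HasWinding r G m) (n : ℕ) :
    HasWinding r (fun z => G z ^ n) (n * m) := by
  induction n with
  | zero => simpa using one hr
  | succ n ih =>
    have := ih.mul h
    simp only [← pow_succ] at this
    convert this using 1
    push_cast; ring

theorem prod_sub (hr : 0 ≤ r) (s : Multiset ℂ) (hs : ∀ a ∈ s, ‖a‖ < r) :
    HasWinding r (fun z => (s.map fun a => z - a).prod) s.card := by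
  induction s using Multiset.induction_on with
  | empty => simpa using one hr
  | cons a s ih =>
    have := (sub_const a (hs a (by simp))).mul (ih fun b hb => hs b (by simp [hb]))
    simpa [add_comm] using this

end HasWinding

/-! ### Zeros of entire functions and Hurwitz's theorem. -/

theorem Differentiable.finite_zeros_closedBall {A : ℂ → ℂ} (hA : Differentiable ℂ A)
    (h0 : ∃ z, A z ≠ 0) (R : ℝ) : {z ∈ Metric.closedBall (0 : ℂ) R | A z = 0}.Finite := by
  obtain ⟨w, hw⟩ := h0
  have han : AnalyticOnNhd ℂ A Set.univ := fun z _ => hA.analyticAt z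
  have h1 := han.preimage_zero_mem_codiscrete (x := w) hw
  have hK : IsCompact (Metric.closedBall (0 : ℂ) R) := isCompact_closedBall _ _
  by_contra hinf
  obtain ⟨z, -, hz⟩ := Set.Infinite.exists_accPt_of_subset_isCompact hinf hK (Set.sep_subset _ _)
  have h2 : ∃ᶠ y in nhdsWithin z {z}ᶜ, A y = 0 :=
    (accPt_iff_frequently_nhdsNE.mp hz).mono fun y hy => hy.2
  have h3 := (han z trivial).eventually_eq_zero_or_eventually_ne_zero.resolve_right
    fun h => (h2.and_eventually h).exists.elim fun y hy => hy.2 hy.1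
  exact hw (congrFun (han.eq_of_eventuallyEq (g := 0) (fun _ _ => analyticAt_const) h3) w)

theorem Differentiable.exists_eq_pow_mul {A : ℂ → ℂ} (hA : Differentiable ℂ A)
    (h0 : ∃ z, A z ≠ 0) (a : ℂ) :
    ∃ (k : ℕ) (B : ℂ → ℂ), Differentiable ℂ B ∧ B a ≠ 0 ∧ ∀ z, A z = (z - a) ^ k * B z := by
  have han : AnalyticOnNhd ℂ A Set.univ := fun z _ => hA.analyticAt z
  have htop : analyticOrderAt A a ≠ ⊤ := by
    intro h
    obtain ⟨w, hw⟩ := h0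
    rw [analyticOrderAt_eq_top] at h
    exact hw (congrFun (han.eq_of_eventuallyEq (g := 0) (fun _ _ => analyticAt_const) h) w)
  obtain ⟨g, hg, hga, hgA⟩ := (han a trivial).analyticOrderAt_ne_top.mp htop
  set k := analyticOrderNatAt A a
  set B : ℂ → ℂ := Function.update (fun z => A z / (z - a) ^ k) a (g a) with hB
  have hBne : ∀ z, z ≠ a → B z = A z / (z - a) ^ k := fun z hz => by simp [hB, hz]
  have hBa : B a = g a := by simp [hB]
  have hBg : B =ᶠ[nhds a] g := by
    filter_upwards [hgA] with z hz
    rcases eq_or_ne z a with rfl | h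
    · exact hBa
    · rw [hBne z h, hz, smul_eq_mul, mul_div_cancel_left₀ _ (pow_ne_zero _ (sub_ne_zero.mpr h))]
  refine ⟨k, B, fun z => ?_, hBa ▸ hga, fun z => ?_⟩
  · rcases eq_or_ne z a with rfl | h
    · exact hg.differentiableAt.congr_of_eventuallyEq hBg
    · have : B =ᶠ[nhds z] fun z => A z / (z - a) ^ k := by
        filter_upwards [isOpen_ne.mem_nhds h] with y hy using hBne y hy
      refine DifferentiableAt.congr_of_eventuallyEq ?_ this
      exact (hA z).div (by fun_prop) (pow_ne_zero _ (sub_ne_zero.mpr h))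
  · rcases eq_or_ne z a with rfl | h
    · rw [hBa]; exact hgA.self_of_nhds
    · rw [hBne z h, mul_div_cancel₀ _ (pow_ne_zero _ (sub_ne_zero.mpr h))]

theorem Differentiable.exists_factorization_closedBall (R : ℝ) {A : ℂ → ℂ}
    (hA : Differentiable ℂ A) (h0 : ∃ z, A z ≠ 0) :
    ∃ (s : Multiset ℂ) (B : ℂ → ℂ), (∀ a ∈ s, ‖a‖ ≤ R) ∧ Differentiable ℂ B ∧
      (∀ z ∈ Metric.closedBall (0 : ℂ) R, B z ≠ 0) ∧
      ∀ z, A z = (s.map fun a => z - a).prod * B z := by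
  -- Induction on the number of distinct zeros: dividing by the full power of `z - a` removes `a`
  -- and creates no new zero.
  induction hN : {z ∈ Metric.closedBall (0 : ℂ) R | A z = 0}.ncard
    using Nat.strong_induction_on generalizing A with
  | _ N ih =>
  by_cases hz : ∃ a ∈ Metric.closedBall (0 : ℂ) R, A a = 0
  · obtain ⟨a, haR, ha⟩ := hz
    obtain ⟨k, B, hB, hBa, hAB⟩ := hA.exists_eq_pow_mul h0 a
    have hsub : {z ∈ Metric.closedBall (0 : ℂ) R | B z = 0} ⊂
        {z ∈ Metric.closedBall (0 : ℂ) R | A z = 0} := by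
      refine (Set.ssubset_iff_of_subset ?_).mpr ⟨a, ⟨haR, ha⟩, fun h => hBa h.2⟩
      exact fun z hz => ⟨hz.1, by simp [hAB, hz.2]⟩
    obtain ⟨s, C, hs, hC, hC0, hBC⟩ := ih _
      (hN ▸ Set.ncard_lt_ncard hsub (hA.finite_zeros_closedBall h0 R)) hB ⟨a, hBa⟩ rfl
    refine ⟨Multiset.replicate k a + s, C, fun b hb => ?_, hC, hC0, fun z => ?_⟩
    · rcases Multiset.mem_add.mp hb with hb | hb
      · rw [Multiset.eq_of_mem_replicate hb]; simpa using haR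
      · exact hs b hb
    · rw [hAB, hBC]; simp [mul_assoc]
  · push Not at hz
    exact ⟨0, A, by simp, hA, hz, by simp⟩

/-- An argument principle: `k` counts the zeros that `B` still has in the disc. -/
theorem HasWinding.exists_card_add {r : ℝ} (hr : 0 ≤ r) {A B : ℂ → ℂ} (hB : Differentiable ℂ B)
    {s : Multiset ℂ} (hs : ∀ a ∈ s, ‖a‖ < r) (hAB : ∀ z, A z = (s.map fun a => z - a).prod * B z)
    (h0 : ∀ z, ‖z‖ = r → A z ≠ 0) : ∃ k : ℕ, HasWinding r A (s.card + k) := by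
  have hB0 : ∀ z, ‖z‖ = r → B z ≠ 0 := fun z hz h => h0 z hz (by simp [hAB, h])
  have hrr : ‖(r : ℂ)‖ = r := by simp [abs_of_nonneg hr]
  obtain ⟨t, C, ht, hC, hC0, hBC⟩ := hB.exists_factorization_closedBall r ⟨r, hB0 _ hrr⟩
  have ht' : ∀ a ∈ t, ‖a‖ < r := by
    intro a ha
    refine (ht a ha).lt_of_ne fun h => hB0 a h ?_
    rw [hBC, Multiset.prod_eq_zero, zero_mul]
    exact Multiset.mem_map.mpr ⟨a, ha, sub_self a⟩
  refine ⟨t.card, ?_⟩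
  have := (HasWinding.prod_sub hr s hs).mul ((HasWinding.prod_sub hr t ht').mul
    (HasWinding.of_continuousOn hr hC.continuous.continuousOn hC0))
  refine HasWinding.congr hr ?_ fun z _ => ((hAB z).trans (by rw [hBC])).symm
  simpa using this

theorem HasWinding.mono {R r : ℝ} (hR : 0 ≤ R) (hRr : R < r) {A : ℂ → ℂ}
    (hA : Differentiable ℂ A) {m k : ℤ} (hm : HasWinding R A m) (hk : HasWinding r A k) :
    m ≤ k := by
  have hne : ∀ {r : ℝ} {m : ℤ}, 0 ≤ r → HasWinding r A m → ∀ z : ℂ, ‖z‖ = r → A z ≠ 0 := by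
    rintro r m hr ⟨c, -, hc, -⟩ z hz
    have : z = circleMap 0 r z.arg := by
      rw [circleMap, ← hz, zero_add, Complex.norm_mul_exp_arg_mul_I]
    rw [this, ← hc]
    exact Complex.exp_ne_zero _
  have hRR : ‖(R : ℂ)‖ = R := by simp [abs_of_nonneg hR]
  obtain ⟨s, B, hs, hB, hB0, hAB⟩ :=
    hA.exists_factorization_closedBall R ⟨R, hne hR hm _ hRR⟩
  have hs' : ∀ a ∈ s, ‖a‖ < R := by
    intro a ha
    refine (hs a ha).lt_of_ne fun h => hne hR hm a h ?_
    rw [hAB, Multiset.prod_eq_zero, zero_mul]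
    exact Multiset.mem_map.mpr ⟨a, ha, sub_self a⟩
  have h1 : HasWinding R A s.card := by
    refine HasWinding.congr hR ?_ fun z _ => (hAB z).symm
    simpa using (HasWinding.prod_sub hR s hs').mul
      (HasWinding.of_continuousOn hR hB.continuous.continuousOn hB0)
  obtain ⟨j, h2⟩ := HasWinding.exists_card_add (hR.trans hRr.le) hB
    (fun a ha => (hs' a ha).trans hRr) hAB (hne (hR.trans hRr.le) hk)
  rw [hm.unique h1, hk.unique h2]
  lia

/-- A limit of entire functions `A r`, locally uniform as `r → ∞`, where `A r` has exactly `n`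
zeros in the disc of radius `r`, has at most `n` zeros. -/
theorem exists_factorization_of_hasWinding {Φ : ℂ → ℂ} (hΦ : Differentiable ℂ Φ)
    (h0 : ∃ z, Φ z ≠ 0) {A : ℝ → ℂ → ℂ} (hA : ∀ r, Differentiable ℂ (A r)) (n : ℕ)
    (hw : ∀ r, 0 < r → HasWinding r (A r) n)
    (hlim : ∀ R, ∀ ε > 0, ∀ᶠ r in Filter.atTop, ∀ z, ‖z‖ = R → ‖A r z - Φ z‖ < ε) :
    ∃ (s : Multiset ℂ) (Ψ : ℂ → ℂ), Differentiable ℂ Ψ ∧ (∀ z, Ψ z ≠ 0) ∧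
      ∀ z, Φ z = (s.map fun a => z - a).prod * Ψ z := by
  have hbound : ∀ (s : Multiset ℂ) (Ψ : ℂ → ℂ), Differentiable ℂ Ψ →
      (∀ z, Φ z = (s.map fun a => z - a).prod * Ψ z) → s.card ≤ n := by
    intro s Ψ hΨ hs
    obtain ⟨R₀, hR₀, hsR⟩ : ∃ R₀ : ℝ, 0 ≤ R₀ ∧ ∀ a ∈ s, ‖a‖ ≤ R₀ :=
      ⟨(s.map fun a => ‖a‖).sum, Multiset.sum_nonneg (by simp), fun a ha =>
        Multiset.single_le_sum (by simp) _ (Multiset.mem_map_of_mem _ ha)⟩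
    -- Only finitely many radii in this interval meet a zero of `Φ`, so some circle avoids them all.
    obtain ⟨R, ⟨hR1, hR2⟩, hR3⟩ : ((Set.Ioo R₀ (R₀ + 1)) \
        (norm '' {z ∈ Metric.closedBall (0 : ℂ) (R₀ + 1) | Φ z = 0})).Nonempty :=
      ((Set.Ioo_infinite (by linarith)).sdiff
        ((hΦ.finite_zeros_closedBall h0 (R₀ + 1)).image _)).nonempty
    have hRpos : 0 ≤ R := hR₀.trans hR1.le
    have hne : ∀ z, ‖z‖ = R → Φ z ≠ 0 := fun z hz hz0 =>
      hR3 ⟨z, ⟨by simpa [hz] using hR2.le, hz0⟩, hz⟩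
    obtain ⟨k, hk⟩ := HasWinding.exists_card_add hRpos hΨ
      (fun a ha => (hsR a ha).trans_lt hR1) hs hne
    obtain ⟨z₀, hz₀, hmin⟩ := (isCompact_sphere (0 : ℂ) R).exists_isMinOn
      ⟨(R : ℂ), by simp [abs_of_nonneg hRpos]⟩ hΦ.continuous.norm.continuousOn
    have hz₀' : ‖z₀‖ = R := by simpa using hz₀
    obtain ⟨r, hr, hrR⟩ := ((hlim R ‖Φ z₀‖ (norm_pos_iff.mpr (hne _ hz₀'))).and
      (Filter.eventually_gt_atTop R)).exists
    -- Rouché against the minimum of `‖Φ‖` on the circle; `mono` then compares with radius `r`,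
    -- where the winding is `n`.
    have h1 : HasWinding R (A r) (s.card + k) :=
      hk.of_norm_sub_lt hRpos (hA r).continuous.continuousOn fun z hz =>
        (hr z hz).trans_le (hmin (show z ∈ Metric.sphere 0 R by simpa using hz))
    have := h1.mono hRpos hrR (hA r) (hw r (hRpos.trans_lt hrR))
    lia
  by_contra! hcon
  -- If no quotient is ever zero-free, linear factors can be split off forever, against `hbound`.
  have hall : ∀ m : ℕ, ∃ (s : Multiset ℂ) (Ψ : ℂ → ℂ), s.card = m ∧ Differentiable ℂ Ψ ∧
      ∀ z, Φ z = (s.map fun a => z - a).prod * Ψ z := by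
    intro m
    induction m with
    | zero => exact ⟨0, Φ, rfl, hΦ, by simp⟩
    | succ m ih =>
      obtain ⟨s, Ψ, hs, hΨ, hΦΨ⟩ := ih
      obtain ⟨a, ha⟩ : ∃ a, Ψ a = 0 := by
        by_contra! h
        obtain ⟨z, hz⟩ := hcon s Ψ hΨ h
        exact hz (hΦΨ z)
      refine ⟨a ::ₘ s, dslope Ψ a, by simp [hs], ?_, fun z => ?_⟩
      · exact differentiableOn_univ.mp ((Complex.differentiableOn_dslope Filter.univ_mem).mpr
          hΨ.differentiableOn)
      · have := sub_smul_dslope Ψ a z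
        rw [ha, sub_zero, smul_eq_mul] at this
        rw [hΦΨ, ← this]; simp; ring
  obtain ⟨s, Ψ, hs, hΨ, hΦΨ⟩ := hall (n + 1)
  have := hbound s Ψ hΨ hΦΨ
  lia

/-! ### Zero-free entire functions of order at most two. -/

theorem Differentiable.exists_eq_exp {Ψ : ℂ → ℂ} (hΨ : Differentiable ℂ Ψ) (h0 : ∀ z, Ψ z ≠ 0) :
    ∃ h : ℂ → ℂ, Differentiable ℂ h ∧ ∀ z, Ψ z = Complex.exp (h z) := by
  have hd : Differentiable ℂ (_root_.deriv Ψ) :=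
    fun z => (hΨ.analyticAt z).deriv.differentiableAt
  obtain ⟨g, hg⟩ := (hd.div hΨ h0).isExactOn_univ
  have hg' : ∀ z, HasDerivAt g (_root_.deriv Ψ z / Ψ z) z := fun z => hg z trivial
  have hgd : Differentiable ℂ g := fun z => (hg' z).differentiableAt
  have hconst : ∀ z, Ψ z * Complex.exp (-g z) = Ψ 0 * Complex.exp (-g 0) := by
    intro z
    refine is_const_of_deriv_eq_zero (f := fun z => Ψ z * Complex.exp (-g z))
      (by fun_prop) (fun w => ?_) z 0
    have := (hΨ w).hasDerivAt.mul (hg' w).neg.cexp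
    refine this.deriv.trans ?_
    field_simp [h0 w]
    ring
  refine ⟨fun z => g z + (Complex.log (Ψ 0) - g 0), by fun_prop, fun z => ?_⟩
  have := hconst z
  rw [Complex.exp_neg, Complex.exp_neg] at this
  rw [Complex.exp_add, Complex.exp_sub, Complex.exp_log (h0 0)]
  field_simp [Complex.exp_ne_zero] at this ⊢
  linear_combination this

/-- Dividing `h z - h 0` by `z` lowers the growth exponent by one; two applications reduce quadratic
growth to Liouville. -/
theorem Differentiable.dslope_norm_le {h : ℂ → ℂ} (hh : Differentiable ℂ h) {C : ℝ} {n : ℕ}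
    (hC : ∀ z, ‖h z‖ ≤ C * (1 + ‖z‖) ^ (n + 1)) :
    Differentiable ℂ (dslope h 0) ∧ ∃ C', ∀ z, ‖dslope h 0 z‖ ≤ C' * (1 + ‖z‖) ^ n := by
  have hd : Differentiable ℂ (dslope h 0) := differentiableOn_univ.mp
    ((Complex.differentiableOn_dslope Filter.univ_mem).mpr hh.differentiableOn)
  refine ⟨hd, ?_⟩
  obtain ⟨B, hB⟩ := (isCompact_closedBall (0 : ℂ) 1).exists_bound_of_continuousOn
    hd.continuous.continuousOn
  have hC0 : 0 ≤ C := by simpa using (norm_nonneg _).trans (hC 0)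
  have hB0 : 0 ≤ B := (norm_nonneg _).trans (hB 0 (by simp))
  refine ⟨B + 4 * C, fun z => ?_⟩
  have h1 : 1 ≤ (1 + ‖z‖) ^ n := one_le_pow₀ (by linarith [norm_nonneg z])
  rcases le_or_gt ‖z‖ 1 with hz | hz
  · calc ‖dslope h 0 z‖ ≤ B := hB z (by simpa using hz)
      _ ≤ (B + 4 * C) * 1 := by linarith
      _ ≤ _ := by gcongr
  · have hz0 : z ≠ 0 := norm_pos_iff.mp (by linarith)
    rw [dslope_of_ne _ hz0, slope_def_field, sub_zero, norm_div, div_le_iff₀ (by linarith)]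
    have h00 : ‖h 0‖ ≤ C := by simpa using hC 0
    calc ‖h z - h 0‖ ≤ ‖h z‖ + ‖h 0‖ := norm_sub_le _ _
      _ ≤ C * (1 + ‖z‖) ^ (n + 1) + C := by gcongr; exact hC z
      _ = C * ((1 + ‖z‖) ^ n * (1 + ‖z‖) + 1) := by ring
      _ ≤ C * ((1 + ‖z‖) ^ n * (2 * ‖z‖) + (1 + ‖z‖) ^ n * (2 * ‖z‖)) := by
          gcongr
          · linarith
          · nlinarith
      _ = 4 * C * (1 + ‖z‖) ^ n * ‖z‖ := by ring
      _ ≤ _ := by gcongr; linarith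

theorem Differentiable.exists_eq_quadratic {h : ℂ → ℂ} (hh : Differentiable ℂ h) {C : ℝ}
    (hC : ∀ z, ‖h z‖ ≤ C * (1 + ‖z‖) ^ 2) : ∃ a b c : ℂ, ∀ z, h z = a * z ^ 2 + b * z + c := by
  obtain ⟨hd1, C1, hC1⟩ := hh.dslope_norm_le (n := 1) hC
  obtain ⟨hd2, C2, hC2⟩ := hd1.dslope_norm_le (n := 0) (by simpa using hC1)
  obtain ⟨a, ha⟩ := hd2.exists_const_forall_eq_of_bounded
    (isBounded_iff_forall_norm_le.mpr ⟨C2, by rintro _ ⟨z, rfl⟩; simpa using hC2 z⟩)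
  refine ⟨a, dslope h 0 0, h 0, fun z => ?_⟩
  have h1 := sub_smul_dslope h 0 z
  have h2 := sub_smul_dslope (dslope h 0) 0 z
  simp only [sub_zero, smul_eq_mul] at h1 h2
  rw [ha] at h2
  linear_combination -h1 - z * h2

theorem Differentiable.norm_le_of_re_le {h : ℂ → ℂ} (hh : Differentiable ℂ h) {M : ℝ} (hM : 0 < M)
    (hre : ∀ z, (h z).re ≤ M * (1 + ‖z‖) ^ 2) : ∃ C, ∀ z, ‖h z‖ ≤ C * (1 + ‖z‖) ^ 2 := by
  refine ⟨8 * M + 3 * ‖h 0‖, fun z => ?_⟩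
  have hz := norm_nonneg z
  -- With this radius `R - ‖z‖ = ‖z‖ + 1`, so Borel–Carathéodory loses only a constant factor.
  set R := 2 * ‖z‖ + 1 with hR
  have hb := Complex.borelCaratheodory (f := h) (M := M * (1 + R) ^ 2) (R := R) (z := z)
    (by positivity) hh.differentiableOn
    (fun w hw => (hre w).trans (by
      have : ‖w‖ < R := by simpa using hw
      gcongr))
    (by positivity) (by simp [hR]; linarith)
  refine hb.trans ?_
  have h1 : R - ‖z‖ = ‖z‖ + 1 := by rw [hR]; ring
  rw [h1, ← add_div, div_le_iff₀ (by positivity), hR]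
  have h0 := norm_nonneg (h 0)
  have e1 : 2 * (M * (1 + (2 * ‖z‖ + 1)) ^ 2) * ‖z‖ ≤ 8 * M * (1 + ‖z‖) ^ 3 := by
    have : 2 * (M * (1 + (2 * ‖z‖ + 1)) ^ 2) * ‖z‖ = 8 * M * (1 + ‖z‖) ^ 2 * ‖z‖ := by ring
    rw [this, pow_succ _ 2, ← mul_assoc]
    gcongr
    linarith
  have e2 : ‖h 0‖ * (2 * ‖z‖ + 1 + ‖z‖) ≤ 3 * ‖h 0‖ * (1 + ‖z‖) ^ 3 := by
    have : 1 + ‖z‖ ≤ (1 + ‖z‖) ^ 3 := le_self_pow₀ (by linarith) (by norm_num)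
    nlinarith
  nlinarith

theorem Differentiable.exists_eq_exp_quadratic {Ψ : ℂ → ℂ} (hΨ : Differentiable ℂ Ψ)
    (h0 : ∀ z, Ψ z ≠ 0) (s : Multiset ℂ) {C M : ℝ} (hM : 0 ≤ M)
    (hC : ∀ z, ‖(s.map fun a => z - a).prod * Ψ z‖ ≤ C * Real.exp (M * ‖z‖ ^ 2)) :
    ∃ a b c : ℂ, ∀ z, Ψ z = Complex.exp (a * z ^ 2 + b * z + c) := by
  obtain ⟨h, hh, hΨh⟩ := hΨ.exists_eq_exp h0
  obtain ⟨R, hR, hsR⟩ : ∃ R : ℝ, 0 ≤ R ∧ ∀ a ∈ s, ‖a‖ ≤ R :=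
    ⟨(s.map fun a => ‖a‖).sum, Multiset.sum_nonneg (by simp), fun a ha =>
      Multiset.single_le_sum (by simp) _ (Multiset.mem_map_of_mem _ ha)⟩
  obtain ⟨B, hB⟩ := (isCompact_closedBall (0 : ℂ) (R + 1)).exists_bound_of_continuousOn
    hh.continuous.continuousOn
  -- Away from the roots the polynomial has modulus at least `1`, so the growth bound passes to `Ψ`.
  have hprod : ∀ z, R + 1 ≤ ‖z‖ → 1 ≤ ‖(s.map fun a => z - a).prod‖ := by
    intro z hz
    clear hC
    induction s using Multiset.induction_on with
    | empty => simp
    | cons a s ih =>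
      rw [Multiset.map_cons, Multiset.prod_cons, norm_mul]
      refine one_le_mul_of_one_le_of_one_le ?_ (ih fun b hb => hsR b (by simp [hb]))
      linarith [norm_sub_norm_le z a, hsR a (by simp)]
  have hC0 : 0 ≤ C := by
    have := (norm_nonneg _).trans (hC 0)
    simpa using this
  have hre : ∀ z, (h z).re ≤ (|B| + C + M + 1) * (1 + ‖z‖) ^ 2 := by
    intro z
    have hz := norm_nonneg z
    have h1 : 1 ≤ (1 + ‖z‖) ^ 2 := one_le_pow₀ (by linarith)
    rcases le_or_gt ‖z‖ (R + 1) with hzR | hzR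
    · calc (h z).re ≤ ‖h z‖ := Complex.re_le_norm _
        _ ≤ |B| := (hB z (by simpa using hzR)).trans (le_abs_self _)
        _ ≤ (|B| + C + M + 1) * 1 := by linarith
        _ ≤ _ := by gcongr
    · have h2 : Real.exp (h z).re ≤ C * Real.exp (M * ‖z‖ ^ 2) := by
        rw [← Complex.norm_exp, ← hΨh]
        refine le_trans ?_ (hC z)
        rw [norm_mul]
        exact le_mul_of_one_le_left (norm_nonneg _) (hprod z hzR.le)
      have h3 : Real.exp (h z).re ≤ Real.exp (C + M * ‖z‖ ^ 2) := by
        rw [Real.exp_add]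
        refine h2.trans ?_
        gcongr
        linarith [Real.add_one_le_exp C]
      have h4 := Real.exp_le_exp.mp h3
      have hBn := abs_nonneg B
      nlinarith
  obtain ⟨K, hK⟩ := hh.norm_le_of_re_le (by positivity) hre
  obtain ⟨a, b, c, habc⟩ := hh.exists_eq_quadratic hK
  exact ⟨a, b, c, fun z => by rw [hΨh, habc]⟩

/-! ### The two-sided Laplace transform. -/

/-- Functions whose product with every real exponential is integrable. -/
def ExpIntegrable (u : ℝ → ℂ) : Prop :=
  ∀ c : ℝ, Integrable fun t : ℝ => u t * (Real.exp (c * t) : ℂ)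

/-- The two-sided Laplace transform `w ↦ ∫ u(t) exp(wt) dt`. -/
noncomputable def laplace (u : ℝ → ℂ) (w : ℂ) : ℂ := ∫ t : ℝ, u t * Complex.exp (w * t)

namespace ExpIntegrable

variable {u v : ℝ → ℂ}

theorem integrable (hu : ExpIntegrable u) : Integrable u := by simpa using hu 0

theorem integrable_cexp (hu : ExpIntegrable u) (w : ℂ) :
    Integrable fun t : ℝ => u t * Complex.exp (w * t) := by
  refine (hu w.re).mono (hu.integrable.aestronglyMeasurable.mul (by fun_prop)) ?_
  filter_upwards with t
  simp [Complex.norm_exp]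

theorem add (hu : ExpIntegrable u) (hv : ExpIntegrable v) :
    ExpIntegrable fun t => u t + v t := fun c => by
  simpa only [add_mul] using! (hu c).add (hv c)

theorem const_mul (hu : ExpIntegrable u) (a : ℂ) : ExpIntegrable fun t => a * u t := fun c => by
  simpa only [mul_assoc] using (hu c).const_mul a

theorem id_mul (hu : ExpIntegrable u) : ExpIntegrable fun t => (t : ℂ) * u t := fun c => by
  refine ((hu (c + 1)).norm.add (hu (c - 1)).norm).mono'
    (((by fun_prop : AEStronglyMeasurable (fun t : ℝ => (t : ℂ)) volume).mul
      hu.integrable.aestronglyMeasurable).mul (by fun_prop)) ?_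
  filter_upwards with t
  simp only [norm_mul, Complex.norm_real, Real.norm_eq_abs, Real.abs_exp, Pi.add_apply]
  have h1 : |t| ≤ Real.exp t + Real.exp (-t) := by
    have := Real.add_one_le_exp t
    have := Real.add_one_le_exp (-t)
    have := Real.exp_pos t
    have := Real.exp_pos (-t)
    rw [abs_le]; constructor <;> linarith
  have h2 : Real.exp ((c + 1) * t) = Real.exp (c * t) * Real.exp t := by
    rw [← Real.exp_add]; ring_nf
  have h3 : Real.exp ((c - 1) * t) = Real.exp (c * t) * Real.exp (-t) := by
    rw [← Real.exp_add]; ring_nf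
  rw [h2, h3]
  calc |t| * ‖u t‖ * Real.exp (c * t) = ‖u t‖ * Real.exp (c * t) * |t| := by ring
    _ ≤ ‖u t‖ * Real.exp (c * t) * (Real.exp t + Real.exp (-t)) := by gcongr
    _ = _ := by ring

theorem pow_mul (hu : ExpIntegrable u) (k : ℕ) : ExpIntegrable fun t => (t : ℂ) ^ k * u t := by
  induction k with
  | zero => simpa using hu
  | succ k ih => simpa only [pow_succ', mul_assoc] using ih.id_mul

theorem eval_mul (hu : ExpIntegrable u) (p : Polynomial ℂ) :
    ExpIntegrable fun t => p.eval (t : ℂ) * u t := by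
  induction p using Polynomial.induction_on' with
  | add p q hp hq => simpa only [Polynomial.eval_add, add_mul] using hp.add hq
  | monomial k a =>
    simpa only [Polynomial.eval_monomial, mul_assoc] using (hu.pow_mul k).const_mul a

theorem hasDerivAt_laplace (hu : ExpIntegrable u) (w : ℂ) :
    HasDerivAt (laplace u) (laplace (fun t => (t : ℂ) * u t) w) w := by
  have hv := hu.id_mul
  have hb := (hv (w.re + 1)).norm.add (hv (w.re - 1)).norm
  refine (hasDerivAt_integral_of_dominated_loc_of_deriv_le (μ := volume)
    (F := fun (w : ℂ) (t : ℝ) => u t * Complex.exp (w * t))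
    (F' := fun (w : ℂ) (t : ℝ) => (t : ℂ) * u t * Complex.exp (w * t))
    (Metric.ball_mem_nhds w one_pos)
    (Filter.Eventually.of_forall fun w => (hu.integrable_cexp w).aestronglyMeasurable)
    (hu.integrable_cexp w) (hv.integrable_cexp w).aestronglyMeasurable
    (bound := fun t : ℝ => ‖(t : ℂ) * u t * (Real.exp ((w.re + 1) * t) : ℂ)‖ +
      ‖(t : ℂ) * u t * (Real.exp ((w.re - 1) * t) : ℂ)‖) ?_ hb ?_).2
  · filter_upwards with t z hz
    have hz1 : |z.re - w.re| ≤ 1 := by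
      rw [← Complex.sub_re]
      exact (Complex.abs_re_le_norm _).trans (by simpa [dist_eq_norm] using (Metric.mem_ball.mp hz).le)
    obtain ⟨hz2, hz3⟩ := abs_le.mp hz1
    rw [norm_mul, norm_mul _ ((Real.exp _ : ℝ) : ℂ), norm_mul _ ((Real.exp _ : ℝ) : ℂ), ← mul_add]
    gcongr
    simp only [Complex.norm_exp, Complex.norm_real, Real.norm_eq_abs, Real.abs_exp,
      Complex.re_mul_ofReal]
    rcases le_total 0 t with ht | ht
    · refine le_add_of_le_of_nonneg (Real.exp_le_exp.mpr ?_) (Real.exp_pos _).le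
      nlinarith
    · refine le_add_of_nonneg_of_le (Real.exp_pos _).le (Real.exp_le_exp.mpr ?_)
      nlinarith
  · filter_upwards with t z _
    have h1 : HasDerivAt (fun z : ℂ => z * (t : ℂ)) (t : ℂ) z := by
      simpa using (hasDerivAt_id z).mul_const (t : ℂ)
    exact (h1.cexp.const_mul (u t)).congr_deriv (by ring)

theorem differentiable_laplace (hu : ExpIntegrable u) : Differentiable ℂ (laplace u) :=
  fun w => (hu.hasDerivAt_laplace w).differentiableAt

theorem laplace_add (hu : ExpIntegrable u) (hv : ExpIntegrable v) (w : ℂ) :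
    laplace (fun t => u t + v t) w = laplace u w + laplace v w := by
  simp only [laplace, add_mul]
  exact integral_add (hu.integrable_cexp w) (hv.integrable_cexp w)

theorem laplace_sum {ι : Type*} (s : Finset ι) (u : ι → ℝ → ℂ) (hu : ∀ i ∈ s, ExpIntegrable (u i))
    (w : ℂ) : laplace (fun t => ∑ i ∈ s, u i t) w = ∑ i ∈ s, laplace (u i) w := by
  simp only [laplace, Finset.sum_mul]
  exact integral_finsetSum s fun i hi => (hu i hi).integrable_cexp w

end ExpIntegrable

theorem laplace_const_mul (u : ℝ → ℂ) (a w : ℂ) :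
    laplace (fun t => a * u t) w = a * laplace u w := by
  simp only [laplace, mul_assoc]
  exact integral_const_mul _ _

theorem expIntegrable_gaussian {b : ℂ} (hb : 0 < b.re) (c d : ℂ) :
    ExpIntegrable fun t : ℝ => Complex.exp (-b * t ^ 2 + c * t + d) := fun r => by
  refine (integrable_cexp_quadratic hb (c + r) d).congr (Filter.Eventually.of_forall fun t => ?_)
  simp only
  rw [Complex.ofReal_exp, ← Complex.exp_add]
  congr 1
  push_cast
  ring

/-- Multiplication by `t` becomes differentiation in `w`, which preserves the form polynomial times
a fixed exponential. -/
theorem exists_laplace_eval_mul_gaussian {b : ℂ} (hb : 0 < b.re) (c d : ℂ) (q : Polynomial ℂ) :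
    ∃ (P : Polynomial ℂ) (C : ℂ), ∀ w,
      laplace (fun t : ℝ => q.eval (t : ℂ) * Complex.exp (-b * t ^ 2 + c * t + d)) w =
        P.eval w * Complex.exp (w ^ 2 / (4 * b) + c / (2 * b) * w + C) := by
  have hb0 : b ≠ 0 := by rintro rfl; simp at hb
  have hG := expIntegrable_gaussian hb c d
  have hpow : ∀ k : ℕ, ∃ P : Polynomial ℂ, ∀ w,
      laplace (fun t : ℝ => (t : ℂ) ^ k * Complex.exp (-b * t ^ 2 + c * t + d)) w =
        P.eval w * Complex.exp (w ^ 2 / (4 * b) + c / (2 * b) * w + (d + c ^ 2 / (4 * b))) := by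
    intro k
    induction k with
    | zero =>
      refine ⟨Polynomial.C ((Real.pi / b) ^ (1 / 2 : ℂ)), fun w => ?_⟩
      have := integral_cexp_quadratic (b := -b) (by simpa using hb) (c + w) d
      rw [neg_neg] at this
      rw [Polynomial.eval_C, laplace]
      refine Eq.trans (integral_congr_ae (Filter.Eventually.of_forall fun t => ?_))
        (this.trans ?_)
      · simp only [pow_zero, one_mul]
        rw [← Complex.exp_add]
        congr 1
        ring
      · congr 2
        field_simp
        ring
    | succ k ih =>
      obtain ⟨P, hP⟩ := ih
      refine ⟨Polynomial.derivative P + P * (Polynomial.C (1 / (2 * b)) * Polynomial.X +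
        Polynomial.C (c / (2 * b))), fun w => ?_⟩
      have h1 := (hG.pow_mul k).hasDerivAt_laplace w
      rw [funext hP] at h1
      have h2 : HasDerivAt (fun w : ℂ => w ^ 2 / (4 * b) + c / (2 * b) * w + (d + c ^ 2 / (4 * b)))
          (1 / (2 * b) * w + c / (2 * b)) w := by
        have := ((((hasDerivAt_id w).pow 2).div_const (4 * b)).add
          ((hasDerivAt_id w).const_mul (c / (2 * b)))).add_const (d + c ^ 2 / (4 * b))
        refine this.congr_deriv ?_
        simp only [id_eq]
        field_simp
        ring
      have h3 := (P.hasDerivAt w).mul h2.cexp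
      have h4 := h1.unique h3
      simp only [pow_succ' _ k, mul_assoc]
      rw [h4]
      simp
      ring
  -- `C` does not depend on `q`; fixing it first lets the polynomials add up in the induction.
  rw [exists_comm]
  refine ⟨d + c ^ 2 / (4 * b), ?_⟩
  induction q using Polynomial.induction_on' with
  | add p q hp hq =>
    obtain ⟨P, hP⟩ := hp
    obtain ⟨Q, hQ⟩ := hq
    refine ⟨P + Q, fun w => ?_⟩
    simp only [Polynomial.eval_add, add_mul]
    rw [(hG.eval_mul p).laplace_add (hG.eval_mul q), hP, hQ]
  | monomial k a =>
    obtain ⟨P, hP⟩ := hpow k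
    refine ⟨Polynomial.C a * P, fun w => ?_⟩
    simp only [Polynomial.eval_monomial, mul_assoc, Polynomial.eval_mul, Polynomial.eval_C]
    rw [laplace_const_mul, hP]

/-! ### Fourier uniqueness and recovery of a function from its transform. -/

section
open scoped FourierTransform ContDiff

/-- Every test function is the Fourier transform of a Schwartz function, so pairings with it depend
only on the transform. -/
theorem ae_eq_of_fourier_eq {u v : ℝ → ℂ} (hu : Integrable u) (hv : Integrable v)
    (huv : 𝓕 u = 𝓕 v) : u =ᵐ[volume] v := by
  refine ae_eq_of_integral_contDiff_smul_eq hu.locallyIntegrable hv.locallyIntegrable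
    fun g hg hgs => ?_
  have hgc : HasCompactSupport (fun t => (g t : ℂ)) := hgs.comp_left (g := ((↑) : ℝ → ℂ)) (by simp)
  let φ : SchwartzMap ℝ ℂ := hgc.toSchwartzMap (Complex.ofRealCLM.contDiff.comp hg)
  let ψ : SchwartzMap ℝ ℂ := 𝓕⁻ φ
  have hφ : 𝓕 (⇑ψ) = fun t => (g t : ℂ) := by
    rw [← SchwartzMap.fourier_coe, FourierTransform.fourier_fourierInv_eq]
    rfl
  have key : ∀ {w : ℝ → ℂ}, Integrable w → ∫ t, g t • w t = ∫ ξ, 𝓕 w ξ * ψ ξ := by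
    intro w hw
    have := VectorFourier.integral_fourierIntegral_smul_eq_flip (L := innerₗ ℝ)
      Real.continuous_fourierChar continuous_inner hw (ψ.integrable (μ := volume))
    rw [flip_innerₗ] at this
    refine Eq.trans ?_ this.symm
    refine integral_congr_ae (Filter.Eventually.of_forall fun t => ?_)
    have h2 := congrFun hφ t
    change _ = w t • 𝓕 (⇑ψ) t
    rw [h2, smul_eq_mul, mul_comm]
    exact Complex.real_smul
  rw [key hu, key hv, huv]

theorem fourier_eq_laplace (u : ℝ → ℂ) (ξ : ℝ) :
    𝓕 u ξ = laplace u (-2 * Real.pi * Complex.I * ξ) := by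
  rw [Real.fourier_real_eq_integral_exp_smul, laplace]
  refine integral_congr_ae (Filter.Eventually.of_forall fun t => ?_)
  simp only [smul_eq_mul]
  rw [mul_comm]
  congr 2
  push_cast; ring

/-- On the half-line where `Re b * t ≥ 0` the exponent has real part at least `Re c`, and a nonzero
polynomial is bounded below near infinity. -/
theorem exists_le_norm_eval_mul_cexp {Q : Polynomial ℂ} (hQ : Q ≠ 0) {a : ℂ} (ha : a.re ≤ 0)
    (b c : ℂ) : ∃ ε > 0,
      (∀ᶠ t : ℝ in Filter.atTop, ε ≤ ‖Q.eval (t : ℂ) * Complex.exp (-a * t ^ 2 + b * t + c)‖) ∨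
      (∀ᶠ t : ℝ in Filter.atBot, ε ≤ ‖Q.eval (t : ℂ) * Complex.exp (-a * t ^ 2 + b * t + c)‖) := by
  obtain ⟨δ, hδ, hQδ⟩ : ∃ δ > 0, ∀ᶠ t : ℝ in Filter.cocompact ℝ, δ ≤ ‖Q.eval (t : ℂ)‖ := by
    rcases Nat.eq_zero_or_pos Q.natDegree with h | h
    · rw [Polynomial.eq_C_of_natDegree_eq_zero h] at hQ ⊢
      refine ⟨‖Q.coeff 0‖, norm_pos_iff.mpr fun h => hQ (by rw [h, Polynomial.C_0]), ?_⟩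
      simp
    · refine ⟨1, one_pos, ?_⟩
      refine (Q.tendsto_norm_atTop (Polynomial.natDegree_pos_iff_degree_pos.mp h)
        (l := Filter.cocompact ℝ) (z := fun t : ℝ => (t : ℂ)) ?_).eventually_ge_atTop 1
      simpa only [Complex.norm_real] using tendsto_norm_cocompact_atTop (E := ℝ)
  have hre : ∀ t : ℝ, (-a * t ^ 2 + b * t + c).re = -a.re * t ^ 2 + b.re * t + c.re := by
    intro t
    rw [← Complex.ofReal_pow, Complex.add_re, Complex.add_re, Complex.re_mul_ofReal,
      Complex.re_mul_ofReal, Complex.neg_re]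
  have hle : ∀ t : ℝ, 0 ≤ b.re * t → δ ≤ ‖Q.eval (t : ℂ)‖ →
      δ * Real.exp c.re ≤ ‖Q.eval (t : ℂ) * Complex.exp (-a * t ^ 2 + b * t + c)‖ := by
    intro t ht hδt
    rw [norm_mul, Complex.norm_exp, hre]
    gcongr
    nlinarith [sq_nonneg t]
  rw [cocompact_eq_atBot_atTop, Filter.eventually_sup] at hQδ
  refine ⟨δ * Real.exp c.re, by positivity, ?_⟩
  rcases le_total 0 b.re with hb | hb
  · left
    filter_upwards [hQδ.2, Filter.eventually_ge_atTop 0] with t h1 h2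
    exact hle t (mul_nonneg hb h2) h1
  · right
    filter_upwards [hQδ.1, Filter.eventually_le_atBot 0] with t h1 h2
    exact hle t (mul_nonneg_of_nonpos_of_nonpos hb h2) h1

theorem re_pos_of_tendsto_zero {Q : Polynomial ℂ} (hQ : Q ≠ 0) {a b c : ℂ}
    (h : Filter.Tendsto (fun t : ℝ => Q.eval (t : ℂ) * Complex.exp (-a * t ^ 2 + b * t + c))
      (Filter.cocompact ℝ) (nhds 0)) : 0 < a.re := by
  by_contra! ha
  obtain ⟨ε, hε, h1⟩ := exists_le_norm_eval_mul_cexp hQ ha b c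
  have h2 := h.norm.eventually_lt_const (u := ε) (by simpa using hε)
  rw [cocompact_eq_atBot_atTop, Filter.eventually_sup] at h2
  rcases h1 with h1 | h1
  · obtain ⟨t, h3, h4⟩ := (h1.and h2.2).exists
    linarith
  · obtain ⟨t, h3, h4⟩ := (h1.and h2.1).exists
    linarith

theorem re_pos_of_memLp {Q : Polynomial ℂ} (hQ : Q ≠ 0) {a b c : ℂ}
    (h : MemLp (fun t : ℝ => Q.eval (t : ℂ) * Complex.exp (-a * t ^ 2 + b * t + c)) 2 volume) :
    0 < a.re := by
  by_contra! ha
  obtain ⟨ε, hε, h1⟩ := exists_le_norm_eval_mul_cexp hQ ha b c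
  have h2 := h.meas_ge_lt_top (by simp) (by simp) (ε := ⟨ε, hε.le⟩)
    (fun h => hε.ne' (congrArg NNReal.toReal h))
  rcases h1 with h1 | h1
  · obtain ⟨T, hT⟩ := Filter.eventually_atTop.mp h1
    refine (h2.trans_le' (measure_mono (s := Set.Ici T) fun t ht => ?_)).ne Real.volume_Ici
    exact hT t ht
  · obtain ⟨T, hT⟩ := Filter.eventually_atBot.mp h1
    refine (h2.trans_le' (measure_mono (s := Set.Iic T) fun t ht => ?_)).ne Real.volume_Iic
    exact hT t ht

theorem ExpIntegrable.ae_eq_of_laplace_eq {u : ℝ → ℂ} (hu : ExpIntegrable u) {Q : Polynomial ℂ}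
    (hQ : Q ≠ 0) {a b c : ℂ}
    (hL : ∀ w, laplace u w = Q.eval w * Complex.exp (a * w ^ 2 + b * w + c)) :
    ∃ (q : Polynomial ℂ) (a' b' c' : ℂ), u =ᵐ[volume]
      fun t : ℝ => q.eval (t : ℂ) * Complex.exp (-a' * t ^ 2 + b' * t + c') := by
  have hpi : (Real.pi : ℂ) ≠ 0 := Complex.ofReal_ne_zero.mpr Real.pi_ne_zero
  have hI := Complex.I_sq
  set Q' : Polynomial ℂ := Q.comp (Polynomial.C (-2 * Real.pi * Complex.I) * Polynomial.X) with hQ'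
  have hQ'0 : Q' ≠ 0 := by
    intro h
    rcases Polynomial.comp_eq_zero_iff.mp h with h | ⟨-, h⟩
    · exact hQ h
    · have := congrArg (fun p => Polynomial.coeff p 1) h
      simp [hpi] at this
  have hF : ∀ ξ : ℝ, 𝓕 u ξ = Q'.eval (ξ : ℂ) * Complex.exp
      (-(4 * Real.pi ^ 2 * a) * ξ ^ 2 + (-2 * Real.pi * Complex.I * b) * ξ + c) := by
    intro ξ
    rw [fourier_eq_laplace, hL, hQ', Polynomial.eval_comp]
    congr 2
    · simp
    · linear_combination 4 * Real.pi ^ 2 * a * ξ ^ 2 * hI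
  have hFf : 𝓕 u = _ := funext hF
  -- Riemann–Lebesgue makes the Fourier transform vanish at infinity, so its quadratic exponent must
  -- decay.
  have hα : 0 < (4 * Real.pi ^ 2 * a).re := by
    refine re_pos_of_tendsto_zero hQ'0 (b := -2 * Real.pi * Complex.I * b) (c := c) ?_
    rw [← hFf]
    exact Real.zero_at_infty_fourier u
  have ha0 : a ≠ 0 := by rintro rfl; simp at hα
  set H : ℝ → ℂ := fun ξ => Q'.eval (ξ : ℂ) * Complex.exp
      (-(4 * Real.pi ^ 2 * a) * ξ ^ 2 + (-2 * Real.pi * Complex.I * b) * ξ + c) with hH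
  have hHc : Continuous H := by
    have : Continuous fun ξ : ℝ => Q'.eval (ξ : ℂ) := Q'.continuous.comp Complex.continuous_ofReal
    fun_prop
  have hHe : ExpIntegrable H := (expIntegrable_gaussian hα _ _).eval_mul Q'
  obtain ⟨P, C, hP⟩ := exists_laplace_eval_mul_gaussian hα (-2 * Real.pi * Complex.I * b) c Q'
  -- Taking `σ = 2πi` computes `𝓕⁻ H`; `σ = -2πi` computes `𝓕 H`, whose integrability the inversion
  -- theorem needs.
  have hform : ∀ σ : ℂ, σ ^ 2 = -(4 * Real.pi ^ 2) → ∃ b' : ℂ, ∀ t : ℝ, laplace H (σ * t) =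
      (P.comp (Polynomial.C σ * Polynomial.X)).eval (t : ℂ) *
        Complex.exp (-(1 / (4 * a)) * t ^ 2 + b' * t + C) := by
    intro σ hσ
    refine ⟨-2 * Real.pi * Complex.I * b / (2 * (4 * Real.pi ^ 2 * a)) * σ, fun t => ?_⟩
    rw [hP, Polynomial.eval_comp]
    congr 2
    · simp
    · rw [mul_pow, hσ]
      congr 1
      rw [← mul_assoc]
      congr 1
      field_simp
      ring
  have hare : 0 < (1 / (4 * a)).re := by
    have h1 : (4 * Real.pi ^ 2 * a).re = 4 * Real.pi ^ 2 * a.re := by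
      rw [show (4 * Real.pi ^ 2 * a : ℂ) = ((4 * Real.pi ^ 2 : ℝ) : ℂ) * a by push_cast; ring,
        Complex.re_ofReal_mul]
    rw [h1] at hα
    have h2 : 0 < a.re := pos_of_mul_pos_right hα (by positivity)
    have h3 : 0 < Complex.normSq (4 * a) := Complex.normSq_pos.mpr (by simpa using ha0)
    rw [one_div, Complex.inv_re]
    refine div_pos ?_ h3
    simpa using h2
  have hI2 : (2 * Real.pi * Complex.I : ℂ) ^ 2 = -(4 * Real.pi ^ 2) := by
    linear_combination 4 * Real.pi ^ 2 * hI
  have hI2' : (-2 * Real.pi * Complex.I : ℂ) ^ 2 = -(4 * Real.pi ^ 2) := by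
    linear_combination 4 * Real.pi ^ 2 * hI
  obtain ⟨b₁, hb₁⟩ := hform _ hI2
  obtain ⟨b₂, hb₂⟩ := hform _ hI2'
  have hFH : Integrable (𝓕 H) := by
    have : 𝓕 H = _ := funext fun t => (fourier_eq_laplace H t).trans (hb₂ t)
    rw [this]
    exact ((expIntegrable_gaussian hare _ _).eval_mul _).integrable
  have hinv : 𝓕⁻ H = fun t : ℝ => (P.comp (Polynomial.C (2 * Real.pi * Complex.I) *
      Polynomial.X)).eval (t : ℂ) * Complex.exp (-(1 / (4 * a)) * t ^ 2 + b₁ * t + C) := by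
    funext t
    rw [Real.fourierInv_eq_fourier_neg, fourier_eq_laplace, ← hb₁]
    congr 1
    push_cast; ring
  refine ⟨P.comp (Polynomial.C (2 * Real.pi * Complex.I) * Polynomial.X), 1 / (4 * a), b₁, C, ?_⟩
  rw [← hinv]
  refine ae_eq_of_fourier_eq hu.integrable ?_ ?_
  · rw [hinv]
    exact ((expIntegrable_gaussian hare _ _).eval_mul _).integrable
  · rw [hHc.fourier_fourierInv_eq hHe.integrable hFH, hFf]

end

/-! ### Gaussian damping of square-integrable functions. -/

theorem MeasureTheory.MemLp.expIntegrable_mul_gaussian {f : ℝ → ℂ} (hf : MemLp f 2 (volume : Measure ℝ)) {b : ℝ}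
    (hb : 0 < b) : ExpIntegrable fun t => f t * (Real.exp (-b * t ^ 2) : ℂ) := fun c => by
  have hg : MemLp (fun t : ℝ => (Real.exp (-b * t ^ 2 + c * t) : ℂ)) 2 volume := by
    refine (memLp_two_iff_integrable_sq_norm (by fun_prop)).mpr ?_
    refine (integrable_cexp_quadratic (b := (2 * b : ℝ)) (by simpa using hb) (2 * c : ℝ) 0).norm.congr
      (Filter.Eventually.of_forall fun t => ?_)
    simp only [Complex.norm_exp, Complex.norm_real, Real.norm_eq_abs, Real.abs_exp]
    rw [← Real.exp_nat_mul]
    congr 1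
    rw [← Complex.ofReal_pow, add_zero, Complex.add_re, Complex.re_mul_ofReal,
      Complex.re_mul_ofReal, Complex.neg_re, Complex.ofReal_re, Complex.ofReal_re]
    push_cast; ring
  refine (hf.integrable_mul hg).congr (Filter.Eventually.of_forall fun t => ?_)
  simp only [Pi.mul_apply, mul_assoc]
  rw [← Complex.ofReal_mul, ← Real.exp_add]

theorem MeasureTheory.MemLp.norm_laplace_mul_gaussian_le {f : ℝ → ℂ} (hf : MemLp f 2 (volume : Measure ℝ)) :
    ∃ C, ∀ w, ‖laplace (fun t => f t * (Real.exp (-Real.pi * t ^ 2) : ℂ)) w‖ ≤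
      C * Real.exp (1 * ‖w‖ ^ 2) := by
  -- The factor `exp(-t²)` of `exp(-πt²)` secures integrability; the remaining `exp(-(π - 1)t²)`
  -- absorbs `exp(Re w * t)` at the cost of `exp(‖w‖²)`.
  have h1 := (hf.expIntegrable_mul_gaussian (b := 1) one_pos).integrable.norm
  refine ⟨∫ t : ℝ, ‖f t * (Real.exp (-1 * t ^ 2) : ℂ)‖, fun w => ?_⟩
  rw [← integral_mul_const]
  refine norm_integral_le_of_norm_le (h1.mul_const _) (Filter.Eventually.of_forall fun t => ?_)
  simp only [norm_mul, Complex.norm_exp, Complex.norm_real, Real.norm_eq_abs, Real.abs_exp,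
    Complex.re_mul_ofReal, mul_assoc]
  rw [← Real.exp_add, ← Real.exp_add]
  refine mul_le_mul_of_nonneg_left (Real.exp_le_exp.mpr ?_) (norm_nonneg _)
  have h2 : |w.re| ≤ ‖w‖ := Complex.abs_re_le_norm w
  have h3 : w.re ^ 2 ≤ ‖w‖ ^ 2 := sq_le_sq' (neg_le_of_abs_le h2) (le_of_abs_le h2)
  nlinarith [Real.pi_gt_three, sq_nonneg (t - w.re / 2), sq_nonneg t, sq_nonneg w.re]

/-! ### The polyanalytic transform and its entire counterparts on circles. -/

section

variable (P : Polynomial ℂ) (u : ℝ → ℂ)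

/-- The polyanalytic function `∑ₖ (-Re w / 2π)ᵏ Gₖ(w)`, where `Gₖ` is the Laplace transform of
the product of `u` with the `k`-th Hasse derivative of `P`. -/
noncomputable def polyanalyticLaplace (w : ℂ) : ℂ :=
  ∑ k ∈ Finset.range (P.natDegree + 1), (-(w.re : ℂ) / (2 * Real.pi)) ^ k *
    laplace (fun t => (P.hasseDeriv k).eval (t : ℂ) * u t) w

/-- The entire function of `w` that agrees on the circle `‖w‖ = r`, where `v = r⁻²`, with
`polyanalyticLaplace` times a multiple of `w ^ deg P`. -/
noncomputable def circleLaplace (v w : ℂ) : ℂ :=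
  P.leadingCoeff⁻¹ * ∑ k ∈ Finset.range (P.natDegree + 1), (1 + w ^ 2 * v) ^ k *
    ((-(4 * Real.pi) * v) ^ (P.natDegree - k) * w ^ (P.natDegree - k)) *
    laplace (fun t => (P.hasseDeriv k).eval (t : ℂ) * u t) w

variable {P u}

theorem ExpIntegrable.differentiable_circleLaplace (hu : ExpIntegrable u) (v : ℂ) :
    Differentiable ℂ (circleLaplace P u v) := by
  have := fun k => (hu.eval_mul (P.hasseDeriv k)).differentiable_laplace
  unfold circleLaplace
  fun_prop

theorem ExpIntegrable.continuous_circleLaplace (hu : ExpIntegrable u) :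
    Continuous fun z : ℂ × ℂ => circleLaplace P u z.1 z.2 := by
  have := fun k => (hu.eval_mul (P.hasseDeriv k)).differentiable_laplace.continuous
  unfold circleLaplace
  fun_prop

theorem ExpIntegrable.continuous_polyanalyticLaplace (hu : ExpIntegrable u) :
    Continuous (polyanalyticLaplace P u) := by
  have := fun k => (hu.eval_mul (P.hasseDeriv k)).differentiable_laplace.continuous
  unfold polyanalyticLaplace
  fun_prop

/-- Powers of `v` kill every term but `k = deg P`, whose Hasse derivative is the constant leading
coefficient. -/
theorem circleLaplace_zero (hP : P ≠ 0) (w : ℂ) : circleLaplace P u 0 w = laplace u w := by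
  have hl : P.leadingCoeff ≠ 0 := Polynomial.leadingCoeff_ne_zero.mpr hP
  rw [circleLaplace, Finset.sum_range_succ, Finset.sum_eq_zero, zero_add]
  · rw [Polynomial.hasseDeriv_natDegree_eq_C]
    simp only [Polynomial.eval_C]
    rw [laplace_const_mul]
    simp [hl]
  · intro k hk
    have : P.natDegree - k ≠ 0 := by have := Finset.mem_range.mp hk; lia
    simp [this]

theorem circleLaplace_eq {r : ℝ} (hr : 0 < r) {w : ℂ} (hw : ‖w‖ = r) :
    circleLaplace P u ((r : ℂ) ^ 2)⁻¹ w =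
      P.leadingCoeff⁻¹ * (-(4 * Real.pi) * ((r : ℂ) ^ 2)⁻¹) ^ P.natDegree * w ^ P.natDegree *
        polyanalyticLaplace P u w := by
  have hr0 : (r : ℂ) ≠ 0 := by exact_mod_cast hr.ne'
  have hpi : (Real.pi : ℂ) ≠ 0 := Complex.ofReal_ne_zero.mpr Real.pi_ne_zero
  -- On the circle `conj w = r² / w`, which makes `Re w` a rational function of `w`.
  have hre : (r : ℂ) ^ 2 + w ^ 2 = 2 * w * w.re := by
    have h1 : w * (starRingEnd ℂ) w = (r : ℂ) ^ 2 := by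
      rw [Complex.mul_conj, Complex.normSq_eq_norm_sq, hw]; push_cast; rfl
    have h2 : (w.re : ℂ) = (w + (starRingEnd ℂ) w) / 2 := Complex.re_eq_add_conj w
    rw [h2, ← h1]; ring
  rw [circleLaplace, polyanalyticLaplace, mul_assoc, mul_assoc]
  congr 1
  rw [Finset.mul_sum, Finset.mul_sum]
  refine Finset.sum_congr rfl fun k hk => ?_
  obtain ⟨j, hj⟩ := Nat.exists_eq_add_of_le (Nat.lt_succ_iff.mp (Finset.mem_range.mp hk))
  have h1 : 1 + w ^ 2 * ((r : ℂ) ^ 2)⁻¹ =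
      (-(4 * Real.pi) * ((r : ℂ) ^ 2)⁻¹) * w * (-(w.re : ℂ) / (2 * Real.pi)) := by
    field_simp
    linear_combination 2 * hre
  rw [h1, hj, Nat.add_sub_cancel_left]
  generalize -(4 * Real.pi) * ((r : ℂ) ^ 2)⁻¹ = X
  generalize -(w.re : ℂ) / (2 * Real.pi) = Y
  ring

theorem ExpIntegrable.exists_factorization_laplace (hu : ExpIntegrable u) (hP : P ≠ 0)
    (h0 : ∃ z, laplace u z ≠ 0) (hF : ∀ w, polyanalyticLaplace P u w ≠ 0) :
    ∃ (s : Multiset ℂ) (Ψ : ℂ → ℂ), Differentiable ℂ Ψ ∧ (∀ z, Ψ z ≠ 0) ∧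
      ∀ z, laplace u z = (s.map fun a => z - a).prod * Ψ z := by
  refine exists_factorization_of_hasWinding hu.differentiable_laplace h0
    (A := fun r => circleLaplace P u ((r : ℂ) ^ 2)⁻¹)
    (fun r => hu.differentiable_circleLaplace _) P.natDegree (fun r hr => ?_) fun R ε hε => ?_
  · have hr0 : (r : ℂ) ≠ 0 := by exact_mod_cast hr.ne'
    have hpi : (Real.pi : ℂ) ≠ 0 := Complex.ofReal_ne_zero.mpr Real.pi_ne_zero
    have h1 : HasWinding r (fun _ => P.leadingCoeff⁻¹ *
        (-(4 * Real.pi) * ((r : ℂ) ^ 2)⁻¹) ^ P.natDegree) 0 :=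
      HasWinding.of_continuousOn hr.le continuousOn_const fun _ _ => by simp [hP, hr0, hpi]
    have h2 : HasWinding r (polyanalyticLaplace P u) 0 :=
      HasWinding.of_continuousOn hr.le hu.continuous_polyanalyticLaplace.continuousOn
        fun w _ => hF w
    -- The zero-free function contributes `0`, so the whole winding `deg P` comes from the power of
    -- `w`.
    have h3 := (h1.mul ((HasWinding.id hr).pow hr.le P.natDegree)).mul h2
    refine HasWinding.congr hr.le ?_ fun w hw => (circleLaplace_eq hr hw).symm
    simpa using h3
  · have hv : Filter.Tendsto (fun r : ℝ => ((r : ℂ) ^ 2)⁻¹) Filter.atTop (nhds 0) := by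
      have h1 : Filter.Tendsto (fun r : ℝ => (r ^ 2)⁻¹) Filter.atTop (nhds 0) :=
        (Filter.tendsto_pow_atTop two_ne_zero).inv_tendsto_atTop
      have h2 := (Complex.continuous_ofReal.tendsto 0).comp h1
      simpa [Function.comp_def] using h2
    have hc : Continuous fun z : ℂ × ℂ => ‖circleLaplace P u z.1 z.2 - laplace u z.2‖ :=
      (hu.continuous_circleLaplace.sub
        (hu.differentiable_laplace.continuous.comp continuous_snd)).norm
    have h := (isCompact_sphere (0 : ℂ) R).eventually_forall_of_forall_eventually (x₀ := (0 : ℂ))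
      (P := fun v w => ‖circleLaplace P u v w - laplace u w‖ < ε) fun w _ => by
        refine (hc.tendsto (0, w)).eventually_lt_const ?_
        simpa [circleLaplace_zero hP] using hε
    filter_upwards [hv.eventually h] with r hr z hz
    exact hr z (by simpa using hz)

end

/-! ### The short-time Fourier transform and the conclusion. -/

theorem stft_eq_polyanalyticLaplace (p : Polynomial ℂ) {f : ℝ → ℂ}
    (hf : MemLp f 2 (volume : Measure ℝ)) (x ξ : ℝ) :
    stft (fun t : ℝ => p.eval (t : ℂ) * normalizedGaussian t) f x ξ =
      (((2 : ℝ) ^ (1 / 4 : ℝ) * Real.exp (-Real.pi * x ^ 2) : ℝ) : ℂ) *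
        polyanalyticLaplace (p.map (starRingEnd ℂ))
          (fun t => f t * (Real.exp (-Real.pi * t ^ 2) : ℂ))
          (2 * Real.pi * x - 2 * Real.pi * Complex.I * ξ) := by
  set P := p.map (starRingEnd ℂ) with hP
  set u : ℝ → ℂ := fun t => f t * (Real.exp (-Real.pi * t ^ 2) : ℂ) with hu'
  have hu : ExpIntegrable u := hf.expIntegrable_mul_gaussian Real.pi_pos
  set w : ℂ := 2 * Real.pi * x - 2 * Real.pi * Complex.I * ξ with hw
  have hwre : (-(w.re : ℂ) / (2 * Real.pi)) = -x := by
    have hpi : (Real.pi : ℂ) ≠ 0 := Complex.ofReal_ne_zero.mpr Real.pi_ne_zero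
    have : w.re = 2 * Real.pi * x := by simp [hw]
    rw [this]; push_cast; field_simp
  have hsum : polyanalyticLaplace P u w = laplace (fun t : ℝ => P.eval ((t : ℂ) - x) * u t) w := by
    rw [polyanalyticLaplace, hwre]
    simp only [← laplace_const_mul]
    rw [← ExpIntegrable.laplace_sum _ _ fun k _ => (hu.eval_mul _).const_mul _]
    congr 1
    funext t
    -- Expanding about `t` with increment `-x = -Re w / 2π` produces the Hasse derivatives at `t`.
    have h1 : P.eval ((t : ℂ) - x) = (Polynomial.taylor (t : ℂ) P).eval (-x : ℂ) := by
      rw [Polynomial.taylor_eval]; ring_nf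
    rw [h1, Polynomial.eval_eq_sum_range, Polynomial.natDegree_taylor, Finset.sum_mul]
    refine Finset.sum_congr rfl fun k _ => ?_
    rw [Polynomial.taylor_coeff]
    ring
  rw [hsum, stft, laplace, ← integral_const_mul]
  refine integral_congr_ae (Filter.Eventually.of_forall fun t => ?_)
  have hconj : (starRingEnd ℂ) (p.eval ((t - x : ℝ) : ℂ)) = P.eval ((t : ℂ) - x) := by
    have := Polynomial.eval_map_apply (p := p) (starRingEnd ℂ) ((t - x : ℝ) : ℂ)
    rw [Complex.conj_ofReal] at this
    rw [hP, ← this]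
    push_cast; rfl
  simp only [map_mul, normalizedGaussian, Complex.conj_ofReal, hconj, hu']
  have hexp : Complex.exp (-Real.pi * (t - x) ^ 2) *
      Complex.exp (-2 * Real.pi * Complex.I * ξ * t) =
      Complex.exp (-Real.pi * x ^ 2) * (Complex.exp (-Real.pi * t ^ 2) * Complex.exp (w * t)) := by
    simp only [← Complex.exp_add]
    congr 1
    rw [hw]; ring
  push_cast
  linear_combination (f t * P.eval ((t : ℂ) - x) * ((2 ^ (1 / 4 : ℝ) : ℝ) : ℂ)) * hexp

theorem mainTheorem8 (p : Polynomial ℂ) (f : ℝ → ℂ)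
    (hf : MemLp f 2 (volume : Measure ℝ))
    (hV : ∀ x ξ : ℝ, stft (fun t : ℝ => p.eval (t : ℂ) * normalizedGaussian t) f x ξ ≠ 0) :
    ∃ (q : Polynomial ℂ) (a' b' c' : ℂ), 0 < a'.re ∧
      f =ᵐ[(volume : Measure ℝ)] fun x : ℝ =>
        q.eval (x : ℂ) * Complex.exp (-(a' * (x : ℂ) ^ 2 + b' * (x : ℂ) + c')) := by
  set P := p.map (starRingEnd ℂ) with hPdef
  set u : ℝ → ℂ := fun t => f t * (Real.exp (-Real.pi * t ^ 2) : ℂ) with hu'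
  have hu : ExpIntegrable u := hf.expIntegrable_mul_gaussian Real.pi_pos
  have hF : ∀ w, polyanalyticLaplace P u w ≠ 0 := by
    intro w h
    refine hV (w.re / (2 * Real.pi)) (-w.im / (2 * Real.pi)) ?_
    have hw : (2 * Real.pi * ((w.re / (2 * Real.pi) : ℝ) : ℂ) -
        2 * Real.pi * Complex.I * ((-w.im / (2 * Real.pi) : ℝ) : ℂ)) = w := by
      conv_rhs => rw [← Complex.re_add_im w]
      push_cast
      field_simp
      ring
    rw [stft_eq_polyanalyticLaplace p hf, hw, h, mul_zero]
  have hP : P ≠ 0 := by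
    intro h
    exact hF 0 (by simp [polyanalyticLaplace, h, laplace])
  have hfne : ¬ f =ᵐ[volume] 0 := by
    intro h
    refine hF 0 (Finset.sum_eq_zero fun k _ => ?_)
    rw [laplace, integral_eq_zero_of_ae, mul_zero]
    filter_upwards [h] with t ht
    simp [hu', ht]
  have hexp0 : ∀ t : ℝ, (Real.exp (-Real.pi * t ^ 2) : ℂ) ≠ 0 := fun t =>
    Complex.ofReal_ne_zero.mpr (Real.exp_ne_zero _)
  -- A vanishing transform would give `u = 0` by Fourier uniqueness, hence `f = 0`.
  have hL0 : ∃ z, laplace u z ≠ 0 := by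
    by_contra! h
    apply hfne
    have : u =ᵐ[volume] 0 := by
      refine ae_eq_of_fourier_eq hu.integrable (integrable_zero _ _ _) ?_
      funext ξ
      rw [fourier_eq_laplace, fourier_eq_laplace, h]
      simp [laplace]
    filter_upwards [this] with t ht
    exact (mul_eq_zero.mp ht).resolve_right (hexp0 t)
  obtain ⟨s, Ψ, hΨ, hΨ0, hLΨ⟩ := hu.exists_factorization_laplace hP hL0 hF
  obtain ⟨C, hC⟩ := hf.norm_laplace_mul_gaussian_le
  obtain ⟨a, b, c, hΨe⟩ := hΨ.exists_eq_exp_quadratic hΨ0 s zero_le_one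
    fun z => by rw [← hLΨ]; exact hC z
  set Q : Polynomial ℂ := (s.map fun a => Polynomial.X - Polynomial.C a).prod with hQ
  have hQ0 : Q ≠ 0 := (Polynomial.monic_multisetProd_X_sub_C s).ne_zero
  obtain ⟨q, a', b', c', hq⟩ := hu.ae_eq_of_laplace_eq hQ0 (a := a) (b := b) (c := c) fun w => by
    rw [hLΨ, hΨe, hQ, Polynomial.eval_multiset_prod, Multiset.map_map]
    simp
  -- Removing the Gaussian from `u` shifts the quadratic coefficient by `π`; positivity of its real
  -- part is then drawn from `f ∈ L²`.
  have hfq : f =ᵐ[volume] fun t : ℝ =>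
      q.eval (t : ℂ) * Complex.exp (-(a' - Real.pi) * t ^ 2 + b' * t + c') := by
    filter_upwards [hq] with t ht
    refine mul_right_cancel₀ (hexp0 t) (Eq.trans ht ?_)
    rw [mul_assoc, Complex.ofReal_exp, ← Complex.exp_add]
    congr 2
    push_cast; ring
  have hq0 : q ≠ 0 := by
    rintro rfl
    apply hfne
    filter_upwards [hfq] with t ht
    simpa using ht
  refine ⟨q, a' - Real.pi, -b', -c', re_pos_of_memLp hq0 (hf.ae_eq hfq), ?_⟩
  filter_upwards [hfq] with t ht
  rw [ht]
  congr 2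
  ring
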